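/- Let $k,s_1,s_2,s\ge 0$ be integers and let $R$ be a nonzero commutative ring (for instance $\mathbb Z$ or a field). **Diagrams.** A diagram on a finite set $V$ is an equivalence relation on two copies (top row and bottom row) of $V$; its classes are called components. A component meeting both rows is a through class, any other one is a horizontal edge, and $\sharp^p(d)$ is the number of through classes of $d$. To form $d\cdot d'$, place $d$ above $d'$ and identify the bottom row of $d$ with the top row of $d'$; restricting the generated equivalence relation to the outer rows gives the diagram $d\cdot d'$, and $l(d\cdot d')$ denotes the number of components (loops) lying entirely in the middle row. For an equivalence relation $e$ on $V$ and a set $P$ of its classes, let $U(e,P)$ be the diagram both of whose rows are $e$, in which every class in $P$ is joined to its own copy in the other row, all other classes being horizontal edges. **Index sets.** (a) Let $V=\{1,\dots,k\}\times\mathbb Z_2$, with $\mathbb Z_2$ acting on the second factor. In a $\mathbb Z_2$-stable diagram, an $\{e\}$-component contains no two distinct points of one $\mathbb Z_2$-orbit (these components come in pairs), and a $\mathbb Z_2$-component is a union of orbits. Let $J^{2k}_{2s_1+s_2}$ be the set of $\mathbb Z_2$-stable diagrams of the form $U(e,P)$ with $s_1$ pairs of $\{e\}$-through classes and $s_2$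 $\mathbb Z_2$-through classes. For such $d$ let $r_1(d)$ be the number of pairs of $\{e\}$-horizontal edges and $r_2(d)$ the number of $\mathbb Z_2$-horizontal edges in the top row. Let $\alpha(d)=(\alpha_1,\alpha_2,\alpha_3,\alpha_4)$, where the $\alpha_i$ are the partitions formed by the sizes (numbers of orbits in the top row) of, respectively, the pairs of $\{e\}$-through classes, the $\mathbb Z_2$-through classes, the pairs of top $\{e\}$-horizontal edges and the top $\mathbb Z_2$-horizontal edges. (b) Let $\overrightarrow J^{2k}_{2s_1+s_2}\subseteq J^{2k}_{2s_1+s_2}$ consist of the $d$ such that $s_1+s_2+r_1(d)+r_2(d)\le k-1$, or $s_1+s_2+r_1(d)+r_2(d)=k$ and ($r_1(d)\ne0$ or $s_1=k$). (c) Let $J^k_s$ be the set of diagrams of the form $U(e,P)$ on $V=\{1,\dots,k\}$ with $s$ through classes. Let $r(d)$ be the number of horizontal edges in the top row, and let $\alpha(d)=(\alpha_1,\alpha_2)$ be the partitions formed by the numbers of top-row vertices of the through classes and of the top horizontal edges. **Orders.** Fix any strict total order on the possible values of $\alpha$ (for example a lexicographic one). In cases (a) and (b), order the index set totally, first by $2r_1+r_2$,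 then by $r_1+r_2$, then by $\alpha$, with ties broken arbitrarily. In case (c), order it totally, first by $r$, then by $\alpha$, with ties broken arbitrarily. **Gram matrices.** The Gram matrices $G^k_{2s_1+s_2}$, $\overrightarrow G^k_{2s_1+s_2}$ and $G^k_s$ are indexed by $J^{2k}_{2s_1+s_2}$, $\overrightarrow J^{2k}_{2s_1+s_2}$ and $J^k_s$ respectively. With $t=2s_1+s_2$ in the first two cases and $t=s$ in the third, the $(d,d')$ entry is $x^{l(d\cdot d')}\in R[x]$ if $\sharp^p(d\cdot d')=t$, and $0$ otherwise. **Lemma 3.9.** (i) In each of the three cases, for all $d_i,d_j$ in the index set with $d_j$ preceding $d_i$ we have $l(d_i\cdot d_j)\le l(d_i\cdot d_i)$, and $$l(d_i\cdot d_j)<l(d_i\cdot d_i)$$ whenever $\sharp^p(d_i\cdot d_j)=t$ (that is, whenever the corresponding entry of the Gram matrix is nonzero) or $(r_1(d_j),r_2(d_j))\neq(r_1(d_i),r_2(d_i))$ (in case (c): $r(d_j)\ne r(d_i)$). (ii) The determinants $\det G^k_{2s_1+s_2}$, $\det\overrightarrow G^k_{2s_1+s_2}$ and $\det G^k_s$ are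 nonzero polynomials in $x$ with leading coefficient $1$. (An empty matrix has determinant $1$.) -/

import Mathlib

open Polynomial

namespace GramDiag

/-! ### Partition diagrams on two rows of vertices -/

section Diagrams

variable {V : Type}

/-- A partition diagram with vertex set `V` in each row: an equivalence relation on the disjoint
union of the top row (`Sum.inl`) and the bottom row (`Sum.inr`). Its equivalence classes are the
connected components. -/
abbrev Diagram (V : Type) : Type := Setoid (V ⊕ V)

/-- The through classes: connected components that meet both rows. -/
def throughClasses (d : Diagram V) : Set (Set (V ⊕ V)) :=
  {C | C ∈ d.classes ∧ (∃ v, Sum.inl v ∈ C) ∧ (∃ w, Sum.inr w ∈ C)}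

/-- The horizontal edges of the top row: connected components contained in the top row. -/
def topEdges (d : Diagram V) : Set (Set (V ⊕ V)) :=
  {C | C ∈ d.classes ∧ ∀ x ∈ C, ∃ v, x = Sum.inl v}

/-- The propagating number: the number of through classes. -/
noncomputable def propagating (d : Diagram V) : ℕ := (throughClasses d).ncard

/-- Two rows as the upper two (top, middle) of the three rows `V ⊕ (V ⊕ V)`
(top, middle, bottom). -/
def upper : V ⊕ V → V ⊕ (V ⊕ V) := Sum.map id Sum.inl

/-- Two rows as the lower two (middle, bottom) of three rows. -/
def lower : V ⊕ V → V ⊕ (V ⊕ V) := Sum.inr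

/-- Two rows as the outer two (top, bottom) of three rows. -/
def outer : V ⊕ V → V ⊕ (V ⊕ V) := Sum.map id Sum.inr

/-- `d` placed above `d'`, the bottom row of `d` being identified with the top row of `d'`. -/
def stack (d d' : Diagram V) : Setoid (V ⊕ (V ⊕ V)) :=
  Relation.EqvGen.setoid fun x y =>
    (∃ a b, d a b ∧ x = upper a ∧ y = upper b) ∨ (∃ a b, d' a b ∧ x = lower a ∧ y = lower b)

/-- The diagram underlying the product of `d` and `d'`. -/
def comp (d d' : Diagram V) : Diagram V := (stack d d').comap outer

/-- The number of loops in the product of `d` and `d'`: the number of connected components of the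
stacked diagram that lie entirely in the middle row. -/
noncomputable def loops (d d' : Diagram V) : ℕ :=
  {C | C ∈ (stack d d').classes ∧ ∀ x ∈ C, ∃ v, x = Sum.inr (Sum.inl v)}.ncard

/-- The vertex of `V` above or below which a vertex lies. -/
def fold : V ⊕ V → V := Sum.elim id id

/-- The diagram whose top and bottom rows are both the partition `e`, in which each component
belonging to `P` is joined to its own copy in the other row (the identity permutation of the
through classes), and the other components are horizontal edges. -/
def doubled (e : Setoid V) (P : Set (Quotient e)) : Diagram V where
  r a b := e (fold a) (fold b) ∧ (a.isLeft = b.isLeft ∨ Quotient.mk e (fold a) ∈ P)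
  iseqv :=
    { refl := fun _ => ⟨e.refl _, Or.inl rfl⟩
      symm := fun {a b} h => by
        refine ⟨e.symm h.1, h.2.imp Eq.symm fun hP => ?_⟩
        rwa [← Quotient.sound (s := e) h.1]
      trans := fun {a b c} h h' => by
        refine ⟨e.trans h.1 h'.1, ?_⟩
        rcases h.2 with h2 | h2
        · rcases h'.2 with h3 | h3
          · exact Or.inl (h2.trans h3)
          · right
            rwa [Quotient.sound (s := e) h.1]
        · exact Or.inr h2 }

/-- The diagrams of the form `doubled e P`. -/
def IsDoubled (d : Diagram V) : Prop := ∃ (e : Setoid V) (P : Set (Quotient e)), d = doubled e P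

noncomputable instance [Finite V] (S : Set (Diagram V)) : Fintype S :=
  have : Finite (Diagram V) :=
    Finite.of_injective (fun d : Diagram V => fun a b => d a b) fun d d' h =>
      Setoid.ext fun a b => iff_of_eq (congrFun (congrFun h a) b)
  Fintype.ofFinite S

noncomputable instance (S : Set (Diagram V)) : DecidableEq S := Classical.decEq S

/-- The Gram matrix on a set `S` of diagrams with `t` through classes: the entry at `(d, d')` is
`x ^ l(d · d')` if `d · d'` has `t` through classes, and `0` otherwise. -/
noncomputable def gram (R : Type*) [CommRing R] (S : Set (Diagram V)) (t : ℕ) :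
    Matrix S S R[X] :=
  open Classical in
  fun d d' => if propagating (comp d.1 d'.1) = t then X ^ loops d.1 d'.1 else 0

/-- For a family of disjoint nonempty vertex sets, the multiset of their numbers of top-row
vertices. -/
noncomputable def sizes [Finite V] (S : Set (Set (V ⊕ V))) : Multiset ℕ :=
  (Set.toFinite S).toFinset.val.map fun C => {v : V | Sum.inl v ∈ C}.ncard

end Diagrams

/-! ### `ℤ₂`-stable diagrams -/

section Signed

variable {k : ℕ}

/-- The vertices of one row: `k` points times the group `ℤ₂` (written additively). -/
abbrev Row (k : ℕ) : Type := Fin k × ZMod 2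

/-- The action of `ℤ₂` on the vertices. -/
def act (g : ZMod 2) : Row k ⊕ Row k → Row k ⊕ Row k :=
  Sum.map (fun v => (v.1, g + v.2)) (fun v => (v.1, g + v.2))

def IsStable (d : Diagram (Row k)) : Prop := ∀ g p q, d p q → d (act g p) (act g q)

/-- `{e}`-components: no two distinct points of an orbit are connected. -/
def IsEComp (C : Set (Row k ⊕ Row k)) : Prop := ∀ x ∈ C, ∀ g, act g x ∈ C → g = 0

/-- `ℤ₂`-components: unions of orbits. -/
def IsZComp (C : Set (Row k ⊕ Row k)) : Prop := ∀ x ∈ C, ∀ g, act g x ∈ C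

/-- The image of a component in the quotient by `ℤ₂`. A pair of `{e}`-components `C^e, C^g` has one
common image, so counting images of `{e}`-components means counting pairs. -/
def orbits (C : Set (Row k ⊕ Row k)) : Set (Fin k ⊕ Fin k) := Sum.map Prod.fst Prod.fst '' C

def eThrough (d : Diagram (Row k)) : Set (Set (Fin k ⊕ Fin k)) :=
  orbits '' {C | C ∈ throughClasses d ∧ IsEComp C}

def zThrough (d : Diagram (Row k)) : Set (Set (Fin k ⊕ Fin k)) :=
  orbits '' {C | C ∈ throughClasses d ∧ IsZComp C}

def eEdges (d : Diagram (Row k)) : Set (Set (Fin k ⊕ Fin k)) :=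
  orbits '' {C | C ∈ topEdges d ∧ IsEComp C}

def zEdges (d : Diagram (Row k)) : Set (Set (Fin k ⊕ Fin k)) :=
  orbits '' {C | C ∈ topEdges d ∧ IsZComp C}

/-- The number `r₁` of pairs of `{e}`-horizontal edges in the top row. -/
noncomputable def r1 (d : Diagram (Row k)) : ℕ := (eEdges d).ncard

/-- The number `r₂` of `ℤ₂`-horizontal edges in the top row. -/
noncomputable def r2 (d : Diagram (Row k)) : ℕ := (zEdges d).ncard

/-- The set `J^{2k}_{2s₁+s₂}`: the `ℤ₂`-stable diagrams with equal top and bottom rows and identity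
permutation, having `s₁` pairs of `{e}`-through classes and `s₂` `ℤ₂`-through classes. -/
def J (k s₁ s₂ : ℕ) : Set (Diagram (Row k)) :=
  {d | IsStable d ∧ IsDoubled d ∧ (eThrough d).ncard = s₁ ∧ (zThrough d).ncard = s₂}

/-- The subset of `J` that belongs to the signed partition algebra. -/
def JSigned (k s₁ s₂ : ℕ) : Set (Diagram (Row k)) :=
  {d | d ∈ J k s₁ s₂ ∧ (s₁ + s₂ + r1 d + r2 d < k ∨
    (s₁ + s₂ + r1 d + r2 d = k ∧ (r1 d ≠ 0 ∨ s₁ = k)))}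

/-- Quadruples of integer partitions, each given as the multiset of its parts. -/
abbrev Shape : Type := Multiset ℕ × Multiset ℕ × Multiset ℕ × Multiset ℕ

/-- The underlying partition `α = (α₁, α₂, α₃, α₄)` of a diagram. -/
noncomputable def shape (d : Diagram (Row k)) : Shape :=
  (sizes (eThrough d), sizes (zThrough d), sizes (eEdges d), sizes (zEdges d))

/-- The rules that order diagrams: first by `2r₁ + r₂`, then by `r₁ + r₂`, then by the underlying
partition. -/
def RankLT (lt : Shape → Shape → Prop) (d d' : Diagram (Row k)) : Prop :=
  2 * r1 d + r2 d < 2 * r1 d' + r2 d' ∨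
  (2 * r1 d + r2 d = 2 * r1 d' + r2 d' ∧ r1 d + r2 d < r1 d' + r2 d') ∨
  (2 * r1 d + r2 d = 2 * r1 d' + r2 d' ∧ r1 d + r2 d = r1 d' + r2 d' ∧ lt (shape d) (shape d'))

/-- `r` is a strict total order on `S` that obeys the ordering rules (ties are broken arbitrarily),
where `lt` is the order used to compare underlying partitions. -/
def IsIndexOrder (S : Set (Diagram (Row k))) (lt : Shape → Shape → Prop) (r : S → S → Prop) :
    Prop :=
  IsStrictTotalOrder S r ∧ ∀ d d' : S, RankLT lt d.1 d'.1 → r d d'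

end Signed

/-! ### The diagrams of the partition algebra -/

section Plain

variable {k : ℕ}

/-- The set `J^k_s`: the partition diagrams on `k` points with equal top and bottom rows and
identity permutation, having `s` through classes. -/
def JPlain (k s : ℕ) : Set (Diagram (Fin k)) := {d | IsDoubled d ∧ propagating d = s}

/-- The number of horizontal edges in the top row. -/
noncomputable def rPlain (d : Diagram (Fin k)) : ℕ := (topEdges d).ncard

/-- The underlying partition `(α₁, α₂)` of a diagram. -/
noncomputable def shapePlain (d : Diagram (Fin k)) : Multiset ℕ × Multiset ℕ :=
  (sizes (throughClasses d), sizes (topEdges d))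

def RankLTPlain (lt : Multiset ℕ × Multiset ℕ → Multiset ℕ × Multiset ℕ → Prop)
    (d d' : Diagram (Fin k)) : Prop :=
  rPlain d < rPlain d' ∨ (rPlain d = rPlain d' ∧ lt (shapePlain d) (shapePlain d'))

def IsIndexOrderPlain (S : Set (Diagram (Fin k)))
    (lt : Multiset ℕ × Multiset ℕ → Multiset ℕ × Multiset ℕ → Prop) (r : S → S → Prop) : Prop :=
  IsStrictTotalOrder S r ∧ ∀ d d' : S, RankLTPlain lt d.1 d'.1 → r d d'

end Plain

end GramDiag

/-!
Every loop of `d · d'` contains a bottom edge of `d` and a top edge of `d'`. For doubled diagrams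
this bounds `l(d · d')` by the numbers of horizontal edges `l(d · d)` and `l(d' · d')` of `d` and
`d'`. If both bounds are attained, the horizontal edges of `d` and `d'` coincide. If moreover no
through class is lost in `d · d'`, the through classes coincide too, so `d = d'`.

Hence `2 l(d · d') < l(d · d) + l(d' · d')` for every nonzero off-diagonal entry of a Gram matrix.
Summing this along a permutation shows that the diagonal product is the only term of top degree
in the Leibniz expansion of the determinant.
-/

namespace GramDiag

section ClassCount

variable {V β : Type*}

/-- The number of classes of the partition `s` that meet `A`. Through classes, horizontal edges and
loops are all counted in this form, as classes within one row. -/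
noncomputable def classCount (s : Setoid V) (A : Set V) : ℕ :=
  (Quotient.mk s '' A).ncard

theorem ncard_classes_eq_classCount_comap {s : Setoid β} {Q : Set β → Prop} (f : V → β)
    (hf : ∀ y, Q {x | s x y} → ∃ v, s (f v) y) :
    {C | C ∈ s.classes ∧ Q C}.ncard = classCount (s.comap f) {v | Q {x | s x (f v)}} := by
  have class_eq {y z : β} (h : s y z) : {x | s x y} = {x | s x z} :=
    Set.ext fun x => ⟨fun hx => s.trans hx h, fun hx => s.trans hx (s.symm h)⟩
  let toClass : Quotient (s.comap f) → Set β :=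
    Quotient.lift (fun v => {x | s x (f v)}) fun _ _ => class_eq
  have toClass_injective : Function.Injective toClass := by
    rintro ⟨v⟩ ⟨w⟩ hvw
    exact Quotient.sound ((Set.ext_iff.1 hvw (f v)).1 (s.refl (f v)))
  rw [classCount, ← Set.ncard_image_of_injective _ toClass_injective, Set.image_image]
  congr 1
  ext C
  constructor
  · rintro ⟨⟨y, rfl⟩, hQ⟩
    obtain ⟨v, hv⟩ := hf y hQ
    exact ⟨v, by rwa [Set.mem_ofPred_eq, class_eq hv], class_eq hv⟩
  · rintro ⟨v, hv, rfl⟩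
    exact ⟨s.mem_classes (f v), hv⟩

variable {s t : Setoid V} {A B : Set V}

theorem classCount_eq_ncard_image_map (hst : s ≤ t) (A : Set V) :
    classCount t A = (Quotient.map id hst '' (Quotient.mk s '' A)).ncard := by
  rw [Set.image_image]
  rfl

variable [Finite V]

theorem classCount_le_classCount (hst : s ≤ t) (hAB : A ⊆ B) :
    classCount t A ≤ classCount s B := by
  rw [classCount_eq_ncard_image_map hst]
  exact (Set.ncard_image_le (Set.toFinite _)).trans (Set.ncard_le_ncard (Set.image_mono hAB))

theorem eq_of_classCount_eq (hst : s ≤ t) (hAB : A ⊆ B)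
    (hA : ∀ ⦃v w⦄, t v w → v ∈ A → w ∈ A) (h : classCount t A = classCount s B) :
    A = B ∧ ∀ ⦃v w⦄, v ∈ A → t v w → s v w := by
  rw [classCount_eq_ncard_image_map hst, classCount] at h
  have himage : Quotient.mk s '' A = Quotient.mk s '' B :=
    Set.eq_of_subset_of_ncard_le (Set.image_mono hAB) (h ▸ Set.ncard_image_le)
  have hinj : Set.InjOn (Quotient.map id hst) (Quotient.mk s '' A) :=
    Set.injOn_of_ncard_image_eq (h.trans (himage ▸ rfl))
  refine ⟨hAB.antisymm fun w hw => ?_, fun v w hv hvw => ?_⟩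
  · obtain ⟨v, hv, hvw⟩ := himage.symm ▸ Set.mem_image_of_mem (Quotient.mk s) hw
    exact hA (hst (Quotient.exact hvw)) hv
  · exact Quotient.exact (hinj ⟨v, hv, rfl⟩ ⟨w, hA hvw hv, rfl⟩ (Quotient.sound hvw))

end ClassCount

section Rows

variable {V : Type} (d : Diagram V)

/-- The top-row vertices that belong to through classes; the others lie on horizontal edges. -/
def throughTop : Set V := {v | ∃ w, d (.inl v) (.inr w)}

/-- The bottom-row vertices that belong to through classes; the others lie on horizontal edges. -/
def throughBottom : Set V := {w | ∃ v, d (.inl v) (.inr w)}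

theorem propagating_eq_classCount_throughTop :
    propagating d = classCount (d.comap Sum.inl) (throughTop d) := by
  rw [propagating, throughClasses, ncard_classes_eq_classCount_comap Sum.inl fun _ h => h.1]
  congr 1
  ext v
  exact ⟨fun h => h.2.imp fun _ => d.symm, fun h => ⟨⟨v, d.refl _⟩, h.imp fun _ => d.symm⟩⟩

theorem propagating_eq_classCount_throughBottom :
    propagating d = classCount (d.comap Sum.inr) (throughBottom d) := by
  rw [propagating, throughClasses, ncard_classes_eq_classCount_comap Sum.inr fun _ h => h.2]
  congr 1
  ext w
  exact ⟨fun h => h.1, fun h => ⟨h, ⟨w, d.refl _⟩⟩⟩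

theorem ncard_topEdges_eq_classCount :
    (topEdges d).ncard = classCount (d.comap Sum.inl) (throughTop d)ᶜ := by
  have exists_top (y) (h : ∀ x ∈ {x | d x y}, ∃ v, x = Sum.inl v) : ∃ v, d (.inl v) y := by
    obtain ⟨v, rfl⟩ := h y (d.refl y)
    exact ⟨v, d.refl _⟩
  rw [topEdges, ncard_classes_eq_classCount_comap Sum.inl exists_top]
  congr 1
  ext v
  constructor
  · rintro h ⟨w, hw⟩
    obtain ⟨u, hu⟩ := h _ (d.symm hw)
    cases hu
  · rintro h (u | u) hu
    exacts [⟨u, rfl⟩, absurd ⟨u, d.symm hu⟩ h]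

variable {d}

theorem mem_throughTop_congr {v w : V} (h : d (.inl v) (.inl w)) :
    v ∈ throughTop d ↔ w ∈ throughTop d :=
  ⟨fun ⟨u, hu⟩ => ⟨u, d.trans (d.symm h) hu⟩, fun ⟨u, hu⟩ => ⟨u, d.trans h hu⟩⟩

theorem top_notMem_throughTop_congr {a b : V ⊕ V} (h : d a b) :
    Sum.elim (· ∉ throughTop d) (fun _ => False) a ↔
      Sum.elim (· ∉ throughTop d) (fun _ => False) b := by
  rcases a with a | a <;> rcases b with b | b
  exacts [not_congr (mem_throughTop_congr h), iff_of_false (not_not.2 ⟨b, h⟩) id,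
    iff_of_false id (not_not.2 ⟨a, d.symm h⟩), Iff.rfl]

theorem mem_topEdges_iff {C : Set (V ⊕ V)} :
    C ∈ topEdges d ↔ ∃ v ∉ throughTop d, C = Sum.inl '' {w | d (.inl w) (.inl v)} := by
  constructor
  · rintro ⟨⟨y, rfl⟩, h⟩
    obtain ⟨v, rfl⟩ := h y (d.refl y)
    refine ⟨v, fun ⟨w, hw⟩ => ?_, Set.ext fun x => ⟨fun hx => ?_, ?_⟩⟩
    · obtain ⟨u, hu⟩ := h _ (d.symm hw)
      cases hu
    · obtain ⟨w, rfl⟩ := h x hx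
      exact ⟨w, hx, rfl⟩
    · rintro ⟨w, hw, rfl⟩
      exact hw
  · rintro ⟨v, hv, rfl⟩
    refine ⟨⟨.inl v, Set.ext fun x => ⟨?_, fun hx => ?_⟩⟩, ?_⟩
    · rintro ⟨w, hw, rfl⟩
      exact hw
    · rcases x with w | w
      exacts [⟨w, hx, rfl⟩, absurd ⟨w, d.symm hx⟩ hv]
    · rintro _ ⟨w, -, rfl⟩
      exact ⟨w, rfl⟩

end Rows

section Doubled

variable {V : Type} {d d' : Diagram V}

theorem mem_throughTop_doubled {e : Setoid V} {P : Set (Quotient e)} {v : V} :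
    v ∈ throughTop (doubled e P) ↔ Quotient.mk e v ∈ P :=
  ⟨fun ⟨_, h⟩ => h.2.resolve_left Bool.noConfusion, fun h => ⟨v, e.refl v, .inr h⟩⟩

namespace IsDoubled

theorem rel_iff (hd : IsDoubled d) {a b : V ⊕ V} :
    d a b ↔ d (.inl (fold a)) (.inl (fold b)) ∧
      (a.isLeft = b.isLeft ∨ fold a ∈ throughTop d) := by
  obtain ⟨e, P, rfl⟩ := hd
  rw [mem_throughTop_doubled]
  exact and_congr_left' (and_iff_left (.inl rfl)).symm

theorem rel_inr_inr (hd : IsDoubled d) {v w : V} :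
    d (.inr v) (.inr w) ↔ d (.inl v) (.inl w) := by
  simp [hd.rel_iff (a := .inr v), fold]

theorem rel_inl_inr (hd : IsDoubled d) {v w : V} :
    d (.inl v) (.inr w) ↔ d (.inl v) (.inl w) ∧ v ∈ throughTop d := by
  simp [hd.rel_iff (a := .inl v) (b := .inr w), fold]

theorem mem_throughTop_of_rel (hd : IsDoubled d) {v w : V} (h : d (.inl v) (.inr w)) :
    w ∈ throughTop d :=
  let ⟨hvw, hv⟩ := hd.rel_inl_inr.1 h
  (mem_throughTop_congr hvw).1 hv

theorem bottom_notMem_throughTop_congr (hd : IsDoubled d) {a b : V ⊕ V} (h : d a b) :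
    Sum.elim (fun _ => False) (· ∉ throughTop d) a ↔
      Sum.elim (fun _ => False) (· ∉ throughTop d) b := by
  rcases a with a | a <;> rcases b with b | b
  exacts [Iff.rfl, iff_of_false id (not_not.2 (hd.mem_throughTop_of_rel h)),
    iff_of_false (not_not.2 (hd.mem_throughTop_of_rel (d.symm h))) id,
    not_congr (mem_throughTop_congr (hd.rel_inr_inr.1 h))]

theorem ext (hd : IsDoubled d) (hd' : IsDoubled d')
    (hrow : d.comap Sum.inl = d'.comap Sum.inl) (hthrough : throughTop d = throughTop d') :
    d = d' := by
  ext a b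
  rw [hd.rel_iff, hd'.rel_iff, hthrough]
  exact and_congr_left' (Setoid.ext_iff.1 hrow (fold a) (fold b))

end IsDoubled

end Doubled

section Stack

variable {V : Type} {d d' : Diagram V}

theorem stack_le {s : Setoid (V ⊕ (V ⊕ V))} (hd : d ≤ s.comap upper) (hd' : d' ≤ s.comap lower) :
    stack d d' ≤ s := by
  refine Setoid.eqvGen_le ?_
  rintro _ _ (⟨a, b, h, rfl, rfl⟩ | ⟨a, b, h, rfl, rfl⟩)
  exacts [hd h, hd' h]

theorem le_stack_upper : d ≤ (stack d d').comap upper := fun {a b} h =>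
  .rel _ _ (.inl ⟨a, b, h, rfl, rfl⟩)

theorem le_stack_lower : d' ≤ (stack d d').comap lower := fun {a b} h =>
  .rel _ _ (.inr ⟨a, b, h, rfl, rfl⟩)

variable (d d') in
/-- The partition of the middle row by the components of the stacked diagram. -/
abbrev middleRow : Setoid V := (stack d d').comap fun v => .inr (.inl v)

variable (d d') in
/-- The vertices of the middle row that belong to loops. -/
def loopVertices : Set V :=
  {v | ∀ x, stack d d' x (.inr (.inl v)) → ∃ w, x = .inr (.inl w)}

variable (d d') in
theorem loops_eq_classCount : loops d d' = classCount (middleRow d d') (loopVertices d d') :=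
  ncard_classes_eq_classCount_comap _ fun y h => by
    obtain ⟨v, rfl⟩ := h y ((stack d d').refl y)
    exact ⟨v, (stack d d').refl _⟩

theorem mem_loopVertices_of_middleRow {v w : V} (h : middleRow d d' v w)
    (hv : v ∈ loopVertices d d') : w ∈ loopVertices d d' :=
  fun x hx => hv x ((stack d d').trans hx ((stack d d').symm h))

namespace IsDoubled

theorem comap_inl_le_middleRow_left (hd : IsDoubled d) : d.comap Sum.inl ≤ middleRow d d' :=
  fun {_ _} h => le_stack_upper (hd.rel_inr_inr.2 h)

theorem stack_top_middle (hd : IsDoubled d) {v : V} (hv : v ∈ throughTop d) :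
    stack d d' (.inl v) (.inr (.inl v)) :=
  le_stack_upper (hd.rel_inl_inr.2 ⟨d.refl _, hv⟩)

theorem stack_bottom_middle (hd' : IsDoubled d') {v : V} (hv : v ∈ throughTop d') :
    stack d d' (.inr (.inr v)) (.inr (.inl v)) :=
  (stack d d').symm (le_stack_lower (hd'.rel_inl_inr.2 ⟨d'.refl _, hv⟩))

theorem loopVertices_subset_left (hd : IsDoubled d) :
    loopVertices d d' ⊆ (throughTop d)ᶜ := fun v hv h => by
  obtain ⟨w, hw⟩ := hv _ (hd.stack_top_middle h)
  cases hw

theorem loopVertices_subset_right (hd' : IsDoubled d') :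
    loopVertices d d' ⊆ (throughTop d')ᶜ := fun v hv h => by
  obtain ⟨w, hw⟩ := hv _ (hd'.stack_bottom_middle h)
  cases hw

end IsDoubled

theorem comap_inl_le_middleRow_right : d'.comap Sum.inl ≤ middleRow d d' :=
  fun {_ _} h => le_stack_lower h

theorem comap_inl_le_comap_inl_comp : d.comap Sum.inl ≤ (comp d d').comap Sum.inl :=
  fun {_ _} h => le_stack_upper h

theorem IsDoubled.comap_inl_le_comap_inr_comp (hd' : IsDoubled d') :
    d'.comap Sum.inl ≤ (comp d d').comap Sum.inr :=
  fun {_ _} h => le_stack_lower (hd'.rel_inr_inr.2 h)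

-- `p`, `q`, `r` cut out sets of vertices in the top, middle and bottom rows; if no edge of `d` or
-- `d'` leaves the set of marked vertices, neither does a component of the stacked diagram.
theorem stack_congr_of_rows {p q r : V → Prop}
    (hd : ∀ a b, d a b → (Sum.elim p q a ↔ Sum.elim p q b))
    (hd' : ∀ a b, d' a b → (Sum.elim q r a ↔ Sum.elim q r b)) {x y : V ⊕ (V ⊕ V)}
    (h : stack d d' x y) : Sum.elim p (Sum.elim q r) x ↔ Sum.elim p (Sum.elim q r) y := by
  refine iff_of_eq (stack_le (s := Setoid.ker (Sum.elim p (Sum.elim q r))) ?_ ?_ h)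
  · rintro (a | a) (b | b) h <;> exact propext (hd _ _ h)
  · exact fun {a b} h => propext (hd' a b h)

variable (d d') in
theorem throughTop_comp_subset : throughTop (comp d d') ⊆ throughTop d := fun _ ⟨_, hvw⟩ =>
  by_contra (stack_congr_of_rows (r := fun _ => False) (fun _ _ => top_notMem_throughTop_congr)
    (fun a b _ => by cases a <;> cases b <;> rfl) hvw).1

namespace IsDoubled

theorem throughBottom_comp_subset (hd' : IsDoubled d') :
    throughBottom (comp d d') ⊆ throughTop d' := fun _ ⟨_, hvw⟩ =>
  by_contra (stack_congr_of_rows (p := fun _ => False) (fun a b _ => by cases a <;> cases b <;> rfl)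
    (fun _ _ => hd'.bottom_notMem_throughTop_congr) hvw).2

theorem rel_of_stack_self (hd : IsDoubled d) {x y : V ⊕ (V ⊕ V)} (h : stack d d x y) :
    d (.inl (Sum.elim id fold x)) (.inl (Sum.elim id fold y)) := by
  refine stack_le (s := (d.comap Sum.inl).comap (Sum.elim id fold)) ?_ ?_ h
  · rintro (a | a) (b | b) h <;> exact (hd.rel_iff.1 h).1
  · exact fun {_ _} h => (hd.rel_iff.1 h).1

theorem comp_self (hd : IsDoubled d) : comp d d = d := by
  have through {v w : V} : comp d d (.inl v) (.inr w) ↔ d (.inl v) (.inr w) := by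
    refine ⟨fun h => hd.rel_inl_inr.2 ⟨hd.rel_of_stack_self h,
      throughTop_comp_subset d d ⟨w, h⟩⟩, fun h => ?_⟩
    exact (stack d d).trans (hd.stack_top_middle (hd.rel_inl_inr.1 h).2) (le_stack_lower h)
  ext a b
  rcases a with a | a <;> rcases b with b | b
  · exact ⟨fun h => hd.rel_of_stack_self h, fun h => comap_inl_le_comap_inl_comp h⟩
  · exact through
  · exact ((comp d d).comm'.trans through).trans d.comm'
  · exact ⟨fun h => hd.rel_inr_inr.2 (hd.rel_of_stack_self h), fun h => le_stack_lower h⟩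

theorem loopVertices_self (hd : IsDoubled d) : loopVertices d d = (throughTop d)ᶜ := by
  refine hd.loopVertices_subset_left.antisymm fun v hv x hx => ?_
  have hx' := (stack_congr_of_rows (fun _ _ => hd.bottom_notMem_throughTop_congr)
    (fun _ _ => top_notMem_throughTop_congr) hx).2 hv
  rcases x with x | x | x
  exacts [hx'.elim, ⟨x, rfl⟩, hx'.elim]

theorem loops_self (hd : IsDoubled d) : loops d d = (topEdges d).ncard := by
  rw [loops_eq_classCount, ncard_topEdges_eq_classCount, hd.loopVertices_self]
  congr 1
  exact le_antisymm (fun {_ _} h => hd.rel_of_stack_self h) comap_inl_le_middleRow_right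

end IsDoubled

end Stack

section LoopBound

variable {V : Type} {d d' : Diagram V}

theorem topEdges_eq_of_rel_iff (hthrough : throughTop d = throughTop d')
    (h : ∀ v ∉ throughTop d, ∀ w, d (.inl v) (.inl w) ↔ d' (.inl v) (.inl w)) :
    topEdges d = topEdges d' := by
  ext C
  rw [mem_topEdges_iff, mem_topEdges_iff, ← hthrough]
  refine exists_congr fun v => and_congr_right fun hv => ?_
  simp only [d.comm' (y := .inl v), d'.comm' (y := .inl v), h v hv]

variable [Finite V]

namespace IsDoubled

theorem loops_le_left (hd : IsDoubled d) : loops d d' ≤ (topEdges d).ncard := by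
  rw [loops_eq_classCount, ncard_topEdges_eq_classCount]
  exact classCount_le_classCount hd.comap_inl_le_middleRow_left hd.loopVertices_subset_left

theorem loops_le_right (hd' : IsDoubled d') : loops d d' ≤ (topEdges d').ncard := by
  rw [loops_eq_classCount, ncard_topEdges_eq_classCount]
  exact classCount_le_classCount comap_inl_le_middleRow_right hd'.loopVertices_subset_right

theorem throughTop_eq_and_rel_iff_of_loops_eq (hd : IsDoubled d) (hd' : IsDoubled d')
    (h : loops d d' = (topEdges d).ncard) (h' : loops d d' = (topEdges d').ncard) :
    throughTop d = throughTop d' ∧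
      ∀ v ∉ throughTop d, ∀ w, d (.inl v) (.inl w) ↔ d' (.inl v) (.inl w) := by
  rw [loops_eq_classCount, ncard_topEdges_eq_classCount] at h h'
  obtain ⟨hA, hrel⟩ := eq_of_classCount_eq hd.comap_inl_le_middleRow_left
    hd.loopVertices_subset_left (fun _ _ => mem_loopVertices_of_middleRow) h
  obtain ⟨hA', hrel'⟩ := eq_of_classCount_eq comap_inl_le_middleRow_right
    hd'.loopVertices_subset_right (fun _ _ => mem_loopVertices_of_middleRow) h'
  refine ⟨compl_injective (hA.symm.trans hA'), fun v hv w => ?_⟩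
  rw [← Set.mem_compl_iff, ← hA] at hv
  exact ⟨fun h => hrel' hv (hd.comap_inl_le_middleRow_left h),
    fun h => hrel hv (comap_inl_le_middleRow_right h)⟩

theorem rel_of_middleRow_left (hd : IsDoubled d) (h : propagating (comp d d') = propagating d)
    {v w : V} (hv : v ∈ throughTop d) (hw : w ∈ throughTop d) (hvw : middleRow d d' v w) :
    d (.inl v) (.inl w) := by
  rw [propagating_eq_classCount_throughTop, propagating_eq_classCount_throughTop] at h
  obtain ⟨hA, hrel⟩ := eq_of_classCount_eq comap_inl_le_comap_inl_comp
    (throughTop_comp_subset d d') (fun _ _ h => (mem_throughTop_congr h).1) h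
  refine hrel (hA ▸ hv) ?_
  exact (stack d d').trans (hd.stack_top_middle hv)
    ((stack d d').trans hvw ((stack d d').symm (hd.stack_top_middle hw)))

theorem rel_of_middleRow_right (hd' : IsDoubled d')
    (h : propagating (comp d d') = propagating d') {v w : V} (hv : v ∈ throughTop d')
    (hw : w ∈ throughTop d') (hvw : middleRow d d' v w) : d' (.inl v) (.inl w) := by
  rw [propagating_eq_classCount_throughBottom, propagating_eq_classCount_throughTop] at h
  obtain ⟨hA, hrel⟩ := eq_of_classCount_eq hd'.comap_inl_le_comap_inr_comp
    hd'.throughBottom_comp_subset (fun _ _ h ⟨u, hu⟩ => ⟨u, (comp d d').trans hu h⟩) h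
  refine hrel (hA ▸ hv) ?_
  exact (stack d d').trans (hd'.stack_bottom_middle hv)
    ((stack d d').trans hvw ((stack d d').symm (hd'.stack_bottom_middle hw)))

theorem eq_of_loops_eq_of_propagating_eq (hd : IsDoubled d) (hd' : IsDoubled d')
    (h : loops d d' = (topEdges d).ncard) (h' : loops d d' = (topEdges d').ncard)
    (hp : propagating (comp d d') = propagating d)
    (hp' : propagating (comp d d') = propagating d') : d = d' := by
  obtain ⟨hthrough, hrel⟩ := hd.throughTop_eq_and_rel_iff_of_loops_eq hd' h h'
  refine hd.ext hd' (Setoid.ext fun v w => ?_) hthrough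
  by_cases hv : v ∈ throughTop d
  · constructor <;> intro hvw
    · have hw := (mem_throughTop_congr hvw).1 hv
      exact hd'.rel_of_middleRow_right hp' (hthrough ▸ hv) (hthrough ▸ hw)
        (hd.comap_inl_le_middleRow_left hvw)
    · have hw := (mem_throughTop_congr hvw).1 (hthrough ▸ hv)
      exact hd.rel_of_middleRow_left hp hv (hthrough ▸ hw) (comap_inl_le_middleRow_right hvw)
  · exact hrel v hv w

theorem two_mul_loops_lt (hd : IsDoubled d) (hd' : IsDoubled d') (hne : d ≠ d')
    (h : propagating (comp d d') = propagating d ∧ propagating (comp d d') = propagating d' ∨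
      topEdges d ≠ topEdges d') :
    2 * loops d d' < loops d d + loops d' d' := by
  have hle : loops d d' ≤ (topEdges d).ncard := hd.loops_le_left
  have hle' : loops d d' ≤ (topEdges d').ncard := hd'.loops_le_right
  rw [hd.loops_self, hd'.loops_self]
  by_contra! hge
  have hl : loops d d' = (topEdges d).ncard := by lia
  have hl' : loops d d' = (topEdges d').ncard := by lia
  rcases h with ⟨hp, hp'⟩ | htop
  · exact hne (hd.eq_of_loops_eq_of_propagating_eq hd' hl hl' hp hp')
  · obtain ⟨hthrough, hrel⟩ := hd.throughTop_eq_and_rel_iff_of_loops_eq hd' hl hl'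
    exact htop (topEdges_eq_of_rel_iff hthrough hrel)

theorem loops_le_loops_self (hd : IsDoubled d) : loops d d' ≤ loops d d :=
  hd.loops_self ▸ hd.loops_le_left

theorem loops_lt_loops_self (hd : IsDoubled d) (hd' : IsDoubled d') (hne : d ≠ d')
    (hle : (topEdges d').ncard ≤ (topEdges d).ncard)
    (h : propagating (comp d d') = propagating d ∧ propagating (comp d d') = propagating d' ∨
      topEdges d ≠ topEdges d') :
    loops d d' < loops d d := by
  have hlt := hd.two_mul_loops_lt hd' hne h
  rw [hd'.loops_self] at hlt
  rw [hd.loops_self] at hlt ⊢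
  lia

end IsDoubled

end LoopBound

section Determinant

variable {ι : Type*} [Fintype ι] {R : Type*} [CommRing R] {A : Matrix ι ι R[X]}

theorem natDegree_prod_perm_lt (hlt : ∀ i j, i ≠ j → A i j ≠ 0 →
      2 * (A i j).natDegree < (A i i).natDegree + (A j j).natDegree)
    {σ : Equiv.Perm ι} (hσ : σ ≠ 1) (hne : ∀ i, A (σ i) i ≠ 0) :
    (∏ i, A (σ i) i).natDegree < ∑ i, (A i i).natDegree := by
  have hle (i : ι) :
      2 * (A (σ i) i).natDegree ≤ (A (σ i) (σ i)).natDegree + (A i i).natDegree := by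
    rcases eq_or_ne (σ i) i with hi | hi
    · rw [hi, two_mul]
    · exact (hlt _ _ hi (hne i)).le
  obtain ⟨m, hm⟩ := not_forall.1 (Equiv.ext_iff.not.1 hσ)
  have hsum : ∑ i, 2 * (A (σ i) i).natDegree <
      ∑ i, ((A (σ i) (σ i)).natDegree + (A i i).natDegree) :=
    Finset.sum_lt_sum (fun i _ => hle i) ⟨m, Finset.mem_univ m, hlt _ _ hm (hne m)⟩
  rw [← Finset.mul_sum, Finset.sum_add_distrib,
    Equiv.sum_comp σ fun i => (A i i).natDegree] at hsum
  have hprod : (∏ i, A (σ i) i).natDegree ≤ ∑ i, (A (σ i) i).natDegree :=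
    natDegree_prod_le _ _
  lia

variable [DecidableEq ι]

theorem monic_det_of_two_mul_natDegree_lt (hdiag : ∀ i, (A i i).Monic)
    (hlt : ∀ i j, i ≠ j → A i j ≠ 0 →
      2 * (A i j).natDegree < (A i i).natDegree + (A j j).natDegree) :
    A.det.Monic := by
  nontriviality R
  rw [Matrix.det_apply, ← Finset.add_sum_erase _ _ (Finset.mem_univ 1), Equiv.Perm.sign_one,
    one_smul]
  have hprod : (∏ i, A i i).Monic := monic_prod_of_monic _ _ fun i _ => hdiag i
  refine hprod.add_of_left ?_
  have bot_lt : ⊥ < (∏ i, A i i).degree := bot_lt_iff_ne_bot.2 (degree_ne_bot.2 hprod.ne_zero)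
  refine (degree_sum_le _ _).trans_lt ((Finset.sup_lt_iff bot_lt).2 fun σ hσ => ?_)
  refine (degree_smul_le _ _).trans_lt ?_
  by_cases hne : ∀ i, A (σ i) i ≠ 0
  · have hdeg := natDegree_prod_perm_lt hlt (Finset.ne_of_mem_erase hσ) hne
    rw [← natDegree_prod_of_monic _ _ fun i _ => hdiag i] at hdeg
    exact degree_lt_degree hdeg
  · obtain ⟨m, hm⟩ := not_forall_not.1 hne
    have hzero : ∏ i, A (σ i) i = 0 := Finset.prod_eq_zero (Finset.mem_univ m) hm
    rwa [hzero, degree_zero]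

end Determinant

section Gram

variable {V : Type} [Finite V] {R : Type*} [CommRing R] {S : Set (Diagram V)} {t : ℕ}

theorem monic_det_gram (hS : ∀ d ∈ S, IsDoubled d ∧ propagating d = t) :
    (gram R S t).det.Monic := by
  nontriviality R
  have gram_of_eq {d d' : S} (h : propagating (comp d.1 d'.1) = t) :
      gram R S t d d' = X ^ loops d.1 d'.1 := if_pos h
  have gram_self (d : S) : gram R S t d d = X ^ loops d.1 d.1 :=
    gram_of_eq (by rw [(hS d d.2).1.comp_self, (hS d d.2).2])
  refine monic_det_of_two_mul_natDegree_lt (fun d => ?_) fun d d' hne hentry => ?_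
  · exact gram_self d ▸ monic_X_pow _
  · have hp : propagating (comp d.1 d'.1) = t := by
      by_contra hp
      exact hentry (if_neg hp)
    obtain ⟨hd, hdt⟩ := hS d d.2
    obtain ⟨hd', hdt'⟩ := hS d' d'.2
    rw [gram_of_eq hp, gram_self, gram_self, natDegree_X_pow, natDegree_X_pow, natDegree_X_pow]
    exact hd.two_mul_loops_lt hd' (Subtype.coe_injective.ne hne)
      (.inl ⟨hp.trans hdt.symm, hp.trans hdt'.symm⟩)

end Gram

section FiberCount

variable {α β : Type*} [Finite α] {φ : α → β} {S : Set α}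

theorem ncard_eq_mul_ncard_image {n : ℕ} (h : ∀ a ∈ S, {b | b ∈ S ∧ φ b = φ a}.ncard = n) :
    S.ncard = n * (φ '' S).ncard := by
  classical
  have := Fintype.ofFinite α
  rw [Set.ncard_eq_toFinset_card', Set.ncard_eq_toFinset_card', Set.toFinset_image,
    Finset.card_eq_sum_card_image φ S.toFinset, Finset.sum_const_nat, mul_comm]
  simp only [Finset.forall_mem_image, Set.mem_toFinset]
  intro a ha
  rw [← h a ha, ← Set.ncard_coe_finset]
  simp

theorem ncard_eq_two_mul_add_ncard_image {σ : α → α} (hσ : Set.MapsTo σ S S)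
    (hφ : ∀ a ∈ S, ∀ b ∈ S, φ b = φ a ↔ b = a ∨ b = σ a) :
    S.ncard = 2 * (φ '' {a | a ∈ S ∧ σ a ≠ a}).ncard + (φ '' {a | a ∈ S ∧ σ a = a}).ncard := by
  have fixed : {a | a ∈ S ∧ σ a = a}.ncard = (φ '' {a | a ∈ S ∧ σ a = a}).ncard := by
    refine (Set.InjOn.ncard_image fun a ha b hb hab => ?_).symm
    simpa only [hb.2, or_self] using (hφ b hb.1 a ha.1).1 hab
  have moved : {a | a ∈ S ∧ σ a ≠ a}.ncard = 2 * (φ '' {a | a ∈ S ∧ σ a ≠ a}).ncard := by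
    refine ncard_eq_mul_ncard_image fun a ⟨ha, hne⟩ => ?_
    rw [← Set.ncard_pair hne.symm]
    congr 1
    ext b
    refine ⟨fun hb => (hφ a ha b hb.1.1).1 hb.2, ?_⟩
    rintro (rfl | rfl)
    · exact ⟨⟨ha, hne⟩, rfl⟩
    · have hσa : φ (σ a) = φ a := (hφ a ha _ (hσ ha)).2 (.inr rfl)
      refine ⟨⟨hσ ha, fun hfix => hne ?_⟩, hσa⟩
      simpa only [hfix, or_self, eq_comm] using (hφ _ (hσ ha) a ha).1 hσa.symm
  rw [← fixed, ← moved, add_comm]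
  exact (Set.ncard_inter_add_ncard_sdiff_eq_ncard S {a | σ a = a}).symm

end FiberCount

section Action

variable {k : ℕ}

theorem act_zero (x : Row k ⊕ Row k) : act 0 x = x := by
  cases x <;> simp [act]

theorem act_one_act_one (x : Row k ⊕ Row k) : act 1 (act 1 x) = x := by
  have hadd (a : ZMod 2) : 1 + (1 + a) = a := by decide +revert
  cases x <;> simp [act, hadd]

theorem sum_map_fst_eq_iff {x y : Row k ⊕ Row k} :
    (Sum.map Prod.fst Prod.fst y : Fin k ⊕ Fin k) = Sum.map Prod.fst Prod.fst x ↔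
      y = x ∨ y = act 1 x := by
  have hadd (a b : ZMod 2) : b = a ∨ b = 1 + a := by decide +revert
  rcases x with ⟨i, a⟩ | ⟨i, a⟩ <;> rcases y with ⟨j, b⟩ | ⟨j, b⟩ <;>
    simp [act, ← and_or_left, hadd]

theorem isZComp_iff_image_act_eq {C : Set (Row k ⊕ Row k)} : IsZComp C ↔ act 1 '' C = C := by
  refine ⟨fun hC => Set.Subset.antisymm ?_ fun x hx => ⟨act 1 x, hC x hx 1, act_one_act_one x⟩,
    fun hC x hx g => ?_⟩
  · rintro _ ⟨x, hx, rfl⟩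
    exact hC x hx 1
  · have hg : g = 0 ∨ g = 1 := by decide +revert
    rcases hg with rfl | rfl
    exacts [(act_zero x).symm ▸ hx, hC ▸ Set.mem_image_of_mem _ hx]

end Action

section Stable

variable {k : ℕ} {d : Diagram (Row k)} {C C' : Set (Row k ⊕ Row k)}

namespace IsStable

theorem image_act_mem_classes (hd : IsStable d) (hC : C ∈ d.classes) :
    act 1 '' C ∈ d.classes := by
  obtain ⟨y, rfl⟩ := hC
  refine ⟨act 1 y, Set.ext fun x => ⟨?_, fun hx => ⟨act 1 x, ?_, act_one_act_one x⟩⟩⟩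
  · rintro ⟨z, hz, rfl⟩
    exact hd 1 _ _ hz
  · simpa only [act_one_act_one, Set.mem_ofPred_eq] using hd 1 _ _ hx

theorem isEComp_iff_image_act_ne (hd : IsStable d) (hC : C ∈ d.classes) :
    IsEComp C ↔ act 1 '' C ≠ C := by
  rw [Ne, ← isZComp_iff_image_act_eq]
  constructor
  · intro hE hZ
    obtain ⟨y, rfl⟩ := hC
    exact absurd (hE y (d.refl y) 1 (hZ y (d.refl y) 1)) one_ne_zero
  · intro hZ x hx g hg
    by_contra hg0
    obtain rfl : g = 1 := Fin.eq_one_of_ne_zero g hg0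
    exact hZ (isZComp_iff_image_act_eq.2 (Setoid.eq_of_mem_classes (hd.image_act_mem_classes hC)
      (Set.mem_image_of_mem _ hx) hC hg))

theorem orbits_eq_iff (hd : IsStable d) (hC : C ∈ d.classes) (hC' : C' ∈ d.classes) :
    orbits C' = orbits C ↔ C' = C ∨ C' = act 1 '' C := by
  constructor
  · intro h
    obtain ⟨y, rfl⟩ := id hC
    obtain ⟨z, hz, hzy⟩ : Sum.map Prod.fst Prod.fst y ∈ orbits C' := h ▸ ⟨y, d.refl y, rfl⟩
    rcases sum_map_fst_eq_iff.1 hzy with rfl | rfl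
    · exact .inl (Setoid.eq_of_mem_classes hC' hz hC (d.refl _))
    · exact .inr (Setoid.eq_of_mem_classes hC' hz (hd.image_act_mem_classes hC)
        (Set.mem_image_of_mem _ (d.refl y)))
  · rintro (rfl | rfl)
    · rfl
    · rw [orbits, Set.image_image]
      exact Set.image_congr fun x _ => sum_map_fst_eq_iff.2 (.inr rfl)

theorem ncard_eq_two_mul_add (hd : IsStable d) {S : Set (Set (Row k ⊕ Row k))}
    (hS : S ⊆ d.classes) (hact : Set.MapsTo (act 1 '' ·) S S) :
    S.ncard = 2 * (orbits '' {C | C ∈ S ∧ IsEComp C}).ncard +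
      (orbits '' {C | C ∈ S ∧ IsZComp C}).ncard := by
  rw [ncard_eq_two_mul_add_ncard_image hact fun C hC C' hC' => hd.orbits_eq_iff (hS hC) (hS hC')]
  simp only [isZComp_iff_image_act_eq]
  congr! 5
  exact Set.ext fun C => and_congr_right fun hC => (hd.isEComp_iff_image_act_ne (hS hC)).symm

theorem propagating_eq (hd : IsStable d) :
    propagating d = 2 * (eThrough d).ncard + (zThrough d).ncard := by
  refine hd.ncard_eq_two_mul_add (fun C hC => hC.1) ?_
  rintro C ⟨hC, ⟨v, hv⟩, ⟨w, hw⟩⟩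
  exact ⟨hd.image_act_mem_classes hC, ⟨_, .inl v, hv, rfl⟩, ⟨_, .inr w, hw, rfl⟩⟩

theorem ncard_topEdges_eq (hd : IsStable d) : (topEdges d).ncard = 2 * r1 d + r2 d := by
  refine hd.ncard_eq_two_mul_add (fun C hC => hC.1) ?_
  rintro C ⟨hC, h⟩
  refine ⟨hd.image_act_mem_classes hC, ?_⟩
  rintro _ ⟨x, hx, rfl⟩
  obtain ⟨v, rfl⟩ := h x hx
  exact ⟨_, rfl⟩

end IsStable

theorem propagating_of_mem_J {s₁ s₂ : ℕ} (hd : d ∈ J k s₁ s₂) : propagating d = 2 * s₁ + s₂ := by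
  rw [hd.1.propagating_eq, hd.2.2.1, hd.2.2.2]

end Stable

section IndexOrder

variable {k : ℕ}

namespace IsIndexOrder

variable {S : Set (Diagram (Row k))} {lt : Shape → Shape → Prop} {r : S → S → Prop} {d d' : S}

theorem ne (hr : IsIndexOrder S lt r) (h : r d' d) : d.1 ≠ d'.1 := by
  have := hr.1
  exact Subtype.coe_injective.ne (ne_of_irrefl' h)

theorem two_mul_r1_add_r2_le (hr : IsIndexOrder S lt r) (h : r d' d) :
    2 * r1 d'.1 + r2 d'.1 ≤ 2 * r1 d.1 + r2 d.1 := by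
  have := hr.1
  exact le_of_not_gt fun hlt => asymm_of r h (hr.2 d d' (.inl hlt))

end IsIndexOrder

namespace IsIndexOrderPlain

variable {S : Set (Diagram (Fin k))} {lt : Multiset ℕ × Multiset ℕ → Multiset ℕ × Multiset ℕ → Prop}
  {r : S → S → Prop} {d d' : S}

theorem ne (hr : IsIndexOrderPlain S lt r) (h : r d' d) : d.1 ≠ d'.1 := by
  have := hr.1
  exact Subtype.coe_injective.ne (ne_of_irrefl' h)

theorem rPlain_le (hr : IsIndexOrderPlain S lt r) (h : r d' d) : rPlain d'.1 ≤ rPlain d.1 := by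
  have := hr.1
  exact le_of_not_gt fun hlt => asymm_of r h (hr.2 d d' (.inl hlt))

end IsIndexOrderPlain

end IndexOrder

end GramDiag

theorem lemma3p9_general (R : Type*) [CommRing R] (k s₁ s₂ s : ℕ) :
    (∀ di ∈ GramDiag.J k s₁ s₂, ∀ dj ∈ GramDiag.J k s₁ s₂, di ≠ dj →
      2 * GramDiag.r1 dj + GramDiag.r2 dj ≤ 2 * GramDiag.r1 di + GramDiag.r2 di →
        GramDiag.loops di dj ≤ GramDiag.loops di di ∧
        (GramDiag.propagating (GramDiag.comp di dj) = 2 * s₁ + s₂ ∨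
            (GramDiag.r1 dj, GramDiag.r2 dj) ≠ (GramDiag.r1 di, GramDiag.r2 di) →
          GramDiag.loops di dj < GramDiag.loops di di)) ∧
    (∀ di ∈ GramDiag.JPlain k s, ∀ dj ∈ GramDiag.JPlain k s, di ≠ dj →
      GramDiag.rPlain dj ≤ GramDiag.rPlain di →
        GramDiag.loops di dj ≤ GramDiag.loops di di ∧
        (GramDiag.propagating (GramDiag.comp di dj) = s ∨
            GramDiag.rPlain dj ≠ GramDiag.rPlain di →
          GramDiag.loops di dj < GramDiag.loops di di)) ∧
    (∀ S ⊆ GramDiag.J k s₁ s₂, (GramDiag.gram R S (2 * s₁ + s₂)).det.Monic) ∧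
    (∀ S ⊆ GramDiag.JPlain k s, (GramDiag.gram R S s).det.Monic) := by
  refine ⟨fun di hi dj hj hne hle => ⟨hi.2.1.loops_le_loops_self, fun h => ?_⟩,
    fun di hi dj hj hne hle => ⟨hi.1.loops_le_loops_self, fun h => ?_⟩,
    fun S hS => GramDiag.monic_det_gram fun d hd =>
      ⟨(hS hd).2.1, GramDiag.propagating_of_mem_J (hS hd)⟩,
    fun S hS => GramDiag.monic_det_gram fun d hd => hS hd⟩
  · rw [← hi.1.ncard_topEdges_eq, ← hj.1.ncard_topEdges_eq] at hle
    refine hi.2.1.loops_lt_loops_self hj.2.1 hne hle (h.imp (fun hp => ?_) fun hr htop => hr ?_)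
    · rw [GramDiag.propagating_of_mem_J hi, GramDiag.propagating_of_mem_J hj]
      exact ⟨hp, hp⟩
    · simp only [GramDiag.r1, GramDiag.r2, GramDiag.eEdges, GramDiag.zEdges, htop]
  · refine hi.1.loops_lt_loops_self hj.1 hne hle (h.imp (fun hp => ?_) fun hr htop => hr ?_)
    · exact ⟨hp.trans hi.2.symm, hp.trans hj.2.symm⟩
    · rw [GramDiag.rPlain, GramDiag.rPlain, htop]

theorem lemma3p9 (R : Type*) [CommRing R] [Nontrivial R] (k s₁ s₂ s : ℕ) :
    -- the algebra of `ℤ₂`-relations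
    (∀ lt : GramDiag.Shape → GramDiag.Shape → Prop, IsStrictTotalOrder GramDiag.Shape lt →
      ∀ r : GramDiag.J k s₁ s₂ → GramDiag.J k s₁ s₂ → Prop,
        GramDiag.IsIndexOrder (GramDiag.J k s₁ s₂) lt r →
        ∀ di dj : GramDiag.J k s₁ s₂, r dj di →
          GramDiag.loops di.1 dj.1 ≤ GramDiag.loops di.1 di.1 ∧
          (GramDiag.propagating (GramDiag.comp di.1 dj.1) = 2 * s₁ + s₂ ∨
              (GramDiag.r1 dj.1, GramDiag.r2 dj.1) ≠ (GramDiag.r1 di.1, GramDiag.r2 di.1) →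
            GramDiag.loops di.1 dj.1 < GramDiag.loops di.1 di.1)) ∧
    -- the signed partition algebra
    (∀ lt : GramDiag.Shape → GramDiag.Shape → Prop, IsStrictTotalOrder GramDiag.Shape lt →
      ∀ r : GramDiag.JSigned k s₁ s₂ → GramDiag.JSigned k s₁ s₂ → Prop,
        GramDiag.IsIndexOrder (GramDiag.JSigned k s₁ s₂) lt r →
        ∀ di dj : GramDiag.JSigned k s₁ s₂, r dj di →
          GramDiag.loops di.1 dj.1 ≤ GramDiag.loops di.1 di.1 ∧
          (GramDiag.propagating (GramDiag.comp di.1 dj.1) = 2 * s₁ + s₂ ∨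
              (GramDiag.r1 dj.1, GramDiag.r2 dj.1) ≠ (GramDiag.r1 di.1, GramDiag.r2 di.1) →
            GramDiag.loops di.1 dj.1 < GramDiag.loops di.1 di.1)) ∧
    -- the partition algebra
    (∀ lt : Multiset ℕ × Multiset ℕ → Multiset ℕ × Multiset ℕ → Prop,
      IsStrictTotalOrder (Multiset ℕ × Multiset ℕ) lt →
      ∀ r : GramDiag.JPlain k s → GramDiag.JPlain k s → Prop,
        GramDiag.IsIndexOrderPlain (GramDiag.JPlain k s) lt r →
        ∀ di dj : GramDiag.JPlain k s, r dj di →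
          GramDiag.loops di.1 dj.1 ≤ GramDiag.loops di.1 di.1 ∧
          (GramDiag.propagating (GramDiag.comp di.1 dj.1) = s ∨
              GramDiag.rPlain dj.1 ≠ GramDiag.rPlain di.1 →
            GramDiag.loops di.1 dj.1 < GramDiag.loops di.1 di.1)) ∧
    -- the determinants
    ((GramDiag.gram R (GramDiag.J k s₁ s₂) (2 * s₁ + s₂)).det ≠ 0 ∧
      (GramDiag.gram R (GramDiag.J k s₁ s₂) (2 * s₁ + s₂)).det.Monic) ∧
    ((GramDiag.gram R (GramDiag.JSigned k s₁ s₂) (2 * s₁ + s₂)).det ≠ 0 ∧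
      (GramDiag.gram R (GramDiag.JSigned k s₁ s₂) (2 * s₁ + s₂)).det.Monic) ∧
    ((GramDiag.gram R (GramDiag.JPlain k s) s).det ≠ 0 ∧
      (GramDiag.gram R (GramDiag.JPlain k s) s).det.Monic) := by
  obtain ⟨hJ, hPlain, monic, monicPlain⟩ := lemma3p9_general R k s₁ s₂ s
  have hSigned : GramDiag.JSigned k s₁ s₂ ⊆ GramDiag.J k s₁ s₂ := fun _ hd => hd.1
  exact ⟨fun _ _ _ hr di dj h => hJ di di.2 dj dj.2 (hr.ne h) (hr.two_mul_r1_add_r2_le h),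
    fun _ _ _ hr di dj h =>
      hJ di (hSigned di.2) dj (hSigned dj.2) (hr.ne h) (hr.two_mul_r1_add_r2_le h),
    fun _ _ _ hr di dj h => hPlain di di.2 dj dj.2 (hr.ne h) (hr.rPlain_le h),
    ⟨(monic _ subset_rfl).ne_zero, monic _ subset_rfl⟩,
    ⟨(monic _ hSigned).ne_zero, monic _ hSigned⟩,
    ⟨(monicPlain _ subset_rfl).ne_zero, monicPlain _ subset_rfl⟩⟩
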